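/- **Model.** Fix a horizon $T\in\mathbb N$. In each slot $t=1,\dots,T$ a triple $(v_t,x_t,q_t)$ is drawn i.i.d. from an unknown distribution $\mathcal D$, where $v_t\in[0,1]$ is a value, $x_t:[0,\infty)\to[0,1]$ is a non-decreasing allocation function with $x_t(0)=0$, and $q_t:[0,\infty)\to[0,1]$ is a non-decreasing payment function with $q_t(b)\le b$ and $q_t(b)=0$ whenever $x_t(b)=0$. Put $p_t(b)=q_t(b)\,x_t(b)$. An online algorithm $\mathcal A$ (possibly randomized, possibly depending on $T$, but not knowing $\mathcal D$) chooses a bid $b_t\ge 0$ as a function of its internal randomness, the past observations $(v_\tau,x_\tau(b_\tau),p_\tau(b_\tau))_{\tau<t}$ and $v_t$. Let $V_{\mathcal A}(T)=\mathbb E\big[\sum_{t=1}^T v_t x_t(b_t)\big]$. The algorithm satisfies the return-on-spend constraint (ROSC) under $\mathcal D$ if $$\mathbb E\Big[\sum_{t=1}^T p_t(b_t)\Big]\le \mathbb E\Big[\sum_{t=1}^T v_t x_t(b_t)\Big],$$ and it respects the ROSC if this holds under every $\mathcal D$. Let $V_{\mathsf{OPT}}(T)$ be the supremum of $V_{\mathcal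 B}(T)$ over all online algorithms $\mathcal B$, allowed to depend on $\mathcal D$, that satisfy the ROSC under $\mathcal D$, and let $\mathcal R_{\mathcal A}(T)=\sup_{\mathcal D}\big(V_{\mathsf{OPT}}(T)-V_{\mathcal A}(T)\big)$ be the regret of $\mathcal A$. **Corollary.** Let $\mathcal A_s$ be the algorithm that always bids $b_t=v_t$. Then $\mathcal A_s$ respects the ROSC for every $T$, and it is order-wise optimal among the algorithms that respect the ROSC. Precisely, there are universal constants $C,c,K>0$ such that for every $T$: $\mathcal R_{\mathcal A_s}(T)\le C\,T$; and every online algorithm $\mathcal A$ that respects the ROSC at horizon $T$ has $\mathcal R_{\mathcal A}(T)\ge c\,T$ and $\mathcal R_{\mathcal A_s}(T)\le K\,\mathcal R_{\mathcal A}(T)$. -/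

import Mathlib

open MeasureTheory
open scoped NNReal

noncomputable section

namespace AutoBidding

/-- The distribution of one ad query `(v, x, q)`: a probability space `Slot` together with a random
value `v`, a random allocation function `x` and a random payment function `q`, the two random
functions being jointly measurable in the outcome and the bid. -/
structure InputLaw where
  Slot : Type
  [measurableSlot : MeasurableSpace Slot]
  law : Measure Slot
  [isProb : IsProbabilityMeasure law]
  v : Slot → ℝ≥0
  x : Slot → ℝ≥0 → ℝ
  q : Slot → ℝ≥0 → ℝ
  measurable_v : Measurable v
  measurable_x : Measurable (Function.uncurry x)
  measurable_q : Measurable (Function.uncurry q)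
  v_le_one : ∀ z, v z ≤ 1
  x_mem : ∀ z b, x z b ∈ Set.Icc (0 : ℝ) 1
  x_mono : ∀ z, Monotone (x z)
  x_zero : ∀ z, x z 0 = 0
  q_mem : ∀ z b, q z b ∈ Set.Icc (0 : ℝ) 1
  q_mono : ∀ z, Monotone (q z)
  q_eq_zero : ∀ z b, x z b = 0 → q z b = 0
  q_le_bid : ∀ z b, q z b ≤ (b : ℝ)

attribute [instance] InputLaw.measurableSlot InputLaw.isProb

/-- The expected payment function `p(b) = q(b) x(b)`. -/
def InputLaw.p (D : InputLaw) (z : D.Slot) (b : ℝ≥0) : ℝ := D.q z b * D.x z b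

/-- What is known about a past slot: `(v_τ, x_τ(b_τ), p_τ(b_τ))`. -/
abbrev Obs : Type := ℝ≥0 × ℝ × ℝ

/-- A (possibly randomized) online algorithm: a random seed, drawn once and independently of the
input, and for every slot a bid that is a measurable function of the seed, of the observations
from the earlier slots and of the present value. Slots are numbered from `0`. -/
structure Algorithm where
  Seed : Type
  [measurableSeed : MeasurableSpace Seed]
  seedLaw : Measure Seed
  [isProb : IsProbabilityMeasure seedLaw]
  bid : (t : ℕ) → Seed → (Fin t → Obs) → ℝ≥0 → ℝ≥0
  measurable_bid : ∀ t : ℕ,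
    Measurable (fun a : Seed × (Fin t → Obs) × ℝ≥0 => bid t a.1 a.2.1 a.2.2)

attribute [instance] Algorithm.measurableSeed Algorithm.isProb

/-- The observations made before slot `t` when `A` is run with seed `s` on the queries `z`. -/
def history (A : Algorithm) (D : InputLaw) (s : A.Seed) (z : ℕ → D.Slot) :
    (t : ℕ) → Fin t → Obs
  | 0 => Fin.elim0
  | t + 1 =>
    let b := A.bid t s (history A D s z t) (D.v (z t))
    Fin.snoc (α := fun _ => Obs) (history A D s z t) (D.v (z t), D.x (z t) b, D.p (z t) b)

/-- The bid `b_t` of `A` in slot `t`. -/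
def bidAt (A : Algorithm) (D : InputLaw) (s : A.Seed) (z : ℕ → D.Slot) (t : ℕ) : ℝ≥0 :=
  A.bid t s (history A D s z t) (D.v (z t))

/-- The joint law of the seed and of the i.i.d. sequence of queries. -/
def runLaw (A : Algorithm) (D : InputLaw) : Measure (A.Seed × (ℕ → D.Slot)) :=
  A.seedLaw.prod (Measure.infinitePi fun _ : ℕ => D.law)

/-- Total expected accrued valuation `V_A(T) = E ∑_t v_t x_t(b_t)` over the first `T` slots. -/
def value (A : Algorithm) (D : InputLaw) (T : ℕ) : ℝ :=
  ∫ w, ∑ t ∈ Finset.range T, (D.v (w.2 t) : ℝ) * D.x (w.2 t) (bidAt A D w.1 w.2 t) ∂runLaw A D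

/-- Total expected payment `E ∑_t p_t(b_t)` over the first `T` slots. -/
def payment (A : Algorithm) (D : InputLaw) (T : ℕ) : ℝ :=
  ∫ w, ∑ t ∈ Finset.range T, D.p (w.2 t) (bidAt A D w.1 w.2 t) ∂runLaw A D

/-- The return-on-spend constraint for `A` under `D` with horizon `T`. -/
def ROSC (A : Algorithm) (D : InputLaw) (T : ℕ) : Prop := payment A D T ≤ value A D T

/-- `A` strictly satisfies the ROSC at horizon `T`: whatever the unknown distribution is. -/
def RespectsROSC (A : Algorithm) (T : ℕ) : Prop := ∀ D : InputLaw, ROSC A D T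

/-- The benchmark `V_OPT(T)`: the best value of an online algorithm that may be tailored to `D` and
satisfies the ROSC under `D`. The supremum is over a set of numbers in `[0, T]`. -/
def optValue (D : InputLaw) (T : ℕ) : ℝ :=
  sSup {r : ℝ | ∃ B : Algorithm, ROSC B D T ∧ value B D T = r}

/-- The worst-case regret. The supremum is over a set of numbers in `[-T, T]`. -/
def regret (A : Algorithm) (T : ℕ) : ℝ :=
  sSup {r : ℝ | ∃ D : InputLaw, optValue D T - value A D T = r}

/-- The algorithm that always bids `b_t = v_t`. -/
def truthful : Algorithm where
  Seed := Unit
  seedLaw := Measure.dirac ()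
  bid := fun _ _ _ v => v
  measurable_bid := fun _ => measurable_snd.comp measurable_snd

end AutoBidding

end

open MeasureTheory
open scoped NNReal

noncomputable section

namespace AutoBidding

/-! The upper bound is trivial: values accrued over `T` slots lie in `[0, T]`. For the lower bound,
take two deterministic laws with value `1/2` on which exactly the bids above `1/2` win. In one (`k =
1`) a winner pays more than the value, so the ROSC forces the algorithm almost surely never to win.
In the other (`k = 0`) winning is free. Losing bids yield the same feedback under both, so an
algorithm respecting the ROSC never wins under the free law either and earns `0` there
(`value_free_eq_zero`), while always bidding `1` earns `T / 2`. Hence its regret is at least `T /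
2`. -/

theorem InputLaw.p_nonneg (D : InputLaw) (z : D.Slot) (b : ℝ≥0) : 0 ≤ D.p z b :=
  mul_nonneg (D.q_mem z b).1 (D.x_mem z b).1

theorem InputLaw.p_le_one (D : InputLaw) (z : D.Slot) (b : ℝ≥0) : D.p z b ≤ 1 :=
  mul_le_one₀ (D.q_mem z b).2 (D.x_mem z b).1 (D.x_mem z b).2

theorem InputLaw.value_mul_x_nonneg (D : InputLaw) (z : D.Slot) (b : ℝ≥0) :
    0 ≤ (D.v z : ℝ) * D.x z b :=
  mul_nonneg (D.v z).2 (D.x_mem z b).1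

theorem InputLaw.value_mul_x_le_one (D : InputLaw) (z : D.Slot) (b : ℝ≥0) :
    (D.v z : ℝ) * D.x z b ≤ 1 :=
  mul_le_one₀ (by exact_mod_cast D.v_le_one z) (D.x_mem z b).1 (D.x_mem z b).2

theorem InputLaw.measurable_p (D : InputLaw) : Measurable (Function.uncurry D.p) :=
  D.measurable_q.mul D.measurable_x

instance (A : Algorithm) (D : InputLaw) : IsProbabilityMeasure (runLaw A D) := by
  unfold runLaw; infer_instance

/-! ### Measurability and integrability of runs -/

theorem measurable_bidAt_of_history (A : Algorithm) (D : InputLaw) (t : ℕ)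
    (h : Measurable fun w : A.Seed × (ℕ → D.Slot) => history A D w.1 w.2 t) :
    Measurable fun w : A.Seed × (ℕ → D.Slot) => bidAt A D w.1 w.2 t :=
  (A.measurable_bid t).comp (measurable_fst.prodMk (h.prodMk
    (D.measurable_v.comp ((measurable_pi_apply t).comp measurable_snd))))

/-- Each new observation evaluates `x` and `p` at a random bid, which is where joint measurability
in outcome and bid is needed. -/
theorem measurable_history (A : Algorithm) (D : InputLaw) (t : ℕ) :
    Measurable fun w : A.Seed × (ℕ → D.Slot) => history A D w.1 w.2 t := by
  induction t with
  | zero => exact measurable_pi_iff.2 fun i => i.elim0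
  | succ t ih =>
    have hb := measurable_bidAt_of_history A D t ih
    have hz : Measurable fun w : A.Seed × (ℕ → D.Slot) => w.2 t :=
      (measurable_pi_apply t).comp measurable_snd
    refine measurable_pi_iff.2 fun i => ?_
    refine Fin.lastCases ?_ (fun j => ?_) i
    · simp only [history, Fin.snoc_last]
      exact (D.measurable_v.comp hz).prodMk
        ((D.measurable_x.comp (hz.prodMk hb)).prodMk (D.measurable_p.comp (hz.prodMk hb)))
    · simp only [history, Fin.snoc_castSucc]
      exact (measurable_pi_apply j).comp ih

theorem measurable_bidAt (A : Algorithm) (D : InputLaw) (t : ℕ) :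
    Measurable fun w : A.Seed × (ℕ → D.Slot) => bidAt A D w.1 w.2 t :=
  measurable_bidAt_of_history A D t (measurable_history A D t)

theorem integrable_slot_value (A : Algorithm) (D : InputLaw) (t : ℕ) :
    Integrable (fun w => (D.v (w.2 t) : ℝ) * D.x (w.2 t) (bidAt A D w.1 w.2 t)) (runLaw A D) := by
  have hz : Measurable fun w : A.Seed × (ℕ → D.Slot) => w.2 t :=
    (measurable_pi_apply t).comp measurable_snd
  refine Integrable.of_bound (C := 1) (Measurable.aestronglyMeasurable ?_)
    (Filter.Eventually.of_forall fun w => ?_)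
  · exact (D.measurable_v.comp hz).coe_nnreal_real.mul
      (D.measurable_x.comp (hz.prodMk (measurable_bidAt A D t)))
  · rw [Real.norm_of_nonneg (D.value_mul_x_nonneg _ _)]
    exact D.value_mul_x_le_one _ _

theorem integrable_slot_payment (A : Algorithm) (D : InputLaw) (t : ℕ) :
    Integrable (fun w => D.p (w.2 t) (bidAt A D w.1 w.2 t)) (runLaw A D) := by
  have hz : Measurable fun w : A.Seed × (ℕ → D.Slot) => w.2 t :=
    (measurable_pi_apply t).comp measurable_snd
  refine Integrable.of_bound (C := 1) (Measurable.aestronglyMeasurable ?_)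
    (Filter.Eventually.of_forall fun w => ?_)
  · exact D.measurable_p.comp (hz.prodMk (measurable_bidAt A D t))
  · rw [Real.norm_of_nonneg (D.p_nonneg _ _)]
    exact D.p_le_one _ _

theorem integrable_total_value (A : Algorithm) (D : InputLaw) (T : ℕ) :
    Integrable (fun w => ∑ t ∈ Finset.range T,
      (D.v (w.2 t) : ℝ) * D.x (w.2 t) (bidAt A D w.1 w.2 t)) (runLaw A D) :=
  integrable_finsetSum _ fun t _ => integrable_slot_value A D t

theorem integrable_total_payment (A : Algorithm) (D : InputLaw) (T : ℕ) :
    Integrable (fun w => ∑ t ∈ Finset.range T, D.p (w.2 t) (bidAt A D w.1 w.2 t))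
      (runLaw A D) :=
  integrable_finsetSum _ fun t _ => integrable_slot_payment A D t

/-! ### Trivial bounds on value, benchmark and regret -/

theorem value_nonneg (A : Algorithm) (D : InputLaw) (T : ℕ) : 0 ≤ value A D T :=
  integral_nonneg fun _ => Finset.sum_nonneg fun _ _ => D.value_mul_x_nonneg _ _

theorem value_le (A : Algorithm) (D : InputLaw) (T : ℕ) : value A D T ≤ T := by
  calc value A D T ≤ ∫ _, (T : ℝ) ∂runLaw A D := by
        refine integral_mono (integrable_total_value A D T) (integrable_const _) fun w => ?_
        refine (Finset.sum_le_sum fun t _ => D.value_mul_x_le_one _ _).trans ?_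
        simp
    _ = T := by simp

/-- Bidding the value never costs more than the value obtained. -/
theorem truthful_respectsROSC (T : ℕ) : RespectsROSC truthful T := fun D =>
  integral_mono (integrable_total_payment truthful D T) (integrable_total_value truthful D T)
    fun w => Finset.sum_le_sum fun t _ =>
      mul_le_mul_of_nonneg_right (D.q_le_bid (w.2 t) (D.v (w.2 t))) (D.x_mem _ _).1

theorem bddAbove_feasible_values (D : InputLaw) (T : ℕ) :
    BddAbove {r : ℝ | ∃ B : Algorithm, ROSC B D T ∧ value B D T = r} :=
  ⟨T, by rintro _ ⟨B, -, rfl⟩; exact value_le B D T⟩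

theorem value_le_optValue {B : Algorithm} {D : InputLaw} {T : ℕ} (h : ROSC B D T) :
    value B D T ≤ optValue D T :=
  le_csSup (bddAbove_feasible_values D T) ⟨B, h, rfl⟩

theorem optValue_le (D : InputLaw) (T : ℕ) : optValue D T ≤ T :=
  -- Truthful bidding shows that the feasible set is nonempty.
  csSup_le ⟨_, truthful, truthful_respectsROSC T D, rfl⟩
    (by rintro _ ⟨B, -, rfl⟩; exact value_le B D T)

theorem optValue_sub_value_le (A : Algorithm) (D : InputLaw) (T : ℕ) :
    optValue D T - value A D T ≤ T := by
  linarith [optValue_le D T, value_nonneg A D T]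

theorem optValue_sub_value_le_regret (A : Algorithm) (D : InputLaw) (T : ℕ) :
    optValue D T - value A D T ≤ regret A T :=
  le_csSup ⟨T, by rintro _ ⟨D, rfl⟩; exact optValue_sub_value_le A D T⟩ ⟨D, rfl⟩

theorem regret_le (A : Algorithm) (T : ℕ) : regret A T ≤ T :=
  Real.sSup_le (by rintro _ ⟨D, rfl⟩; exact optValue_sub_value_le A D T) T.cast_nonneg

/-- A deterministic query of value `1/2`, won exactly by the bids above `1/2`, where a winning
bid `b` is charged `min (k b) 1`. -/
def thresholdLaw (k : ℝ≥0) (hk : k ≤ 1) : InputLaw where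
  Slot := Unit
  law := Measure.dirac ()
  v := fun _ => 1 / 2
  x := fun _ b => if b ≤ 1 / 2 then 0 else 1
  -- The cap at `1` keeps `q` in `[0, 1]`; for `k = 1` a winning charge still exceeds `1/2`.
  q := fun _ b => if b ≤ 1 / 2 then 0 else min (k * b) 1
  measurable_v := measurable_const
  measurable_x := Measurable.ite (measurableSet_le measurable_snd measurable_const)
    measurable_const measurable_const
  measurable_q := Measurable.ite (measurableSet_le measurable_snd measurable_const)
    measurable_const (by fun_prop)
  v_le_one := fun _ => half_le_self zero_le_one
  x_mem := fun _ b => by split_ifs <;> simp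
  x_mono := fun _ a b hab => by
    dsimp only
    split_ifs with ha hb hb
    · exact le_rfl
    · exact zero_le_one
    · exact absurd (hab.trans hb) ha
    · exact le_rfl
  x_zero := fun _ => by simp
  q_mem := fun _ b => by
    split_ifs
    · simp
    · exact ⟨le_min (by positivity) zero_le_one, min_le_right _ _⟩
  q_mono := fun _ a b hab => by
    dsimp only
    split_ifs with ha hb hb
    · exact le_rfl
    · exact le_min (by positivity) zero_le_one
    · exact absurd (hab.trans hb) ha
    · gcongr
  q_eq_zero := fun _ b h => by
    by_cases hb : b ≤ 1 / 2
    · simp only [hb, if_true]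
    · simp only [hb, if_false] at h
      exact absurd h one_ne_zero
  q_le_bid := fun _ b => by
    split_ifs
    · exact b.2
    · exact (min_le_left _ _).trans (mul_le_of_le_one_left b.2 (by exact_mod_cast hk))

/-! ### Indistinguishability of the threshold laws -/

section thresholdLaw

variable {k : ℝ≥0} (hk : k ≤ 1)

theorem thresholdLaw_x_of_le {z : Unit} {b : ℝ≥0} (hb : b ≤ 1 / 2) :
    (thresholdLaw k hk).x z b = 0 := if_pos hb

theorem thresholdLaw_x_of_lt {z : Unit} {b : ℝ≥0} (hb : 1 / 2 < b) :
    (thresholdLaw k hk).x z b = 1 := if_neg hb.not_ge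

theorem thresholdLaw_p_of_le {z : Unit} {b : ℝ≥0} (hb : b ≤ 1 / 2) :
    (thresholdLaw k hk).p z b = 0 := by
  unfold InputLaw.p
  rw [thresholdLaw_x_of_le hk hb, mul_zero]

theorem thresholdLaw_p_of_lt {z : Unit} {b : ℝ≥0} (hb : 1 / 2 < b) :
    (thresholdLaw k hk).p z b = min (k * b : ℝ) 1 := by
  unfold InputLaw.p
  rw [thresholdLaw_x_of_lt hk hb, mul_one]
  exact if_neg hb.not_ge

theorem thresholdLaw_v (z : Unit) : (((thresholdLaw k hk).v z : ℝ≥0) : ℝ) = 1 / 2 := by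
  change (((1 / 2 : ℝ≥0)) : ℝ) = 1 / 2
  push_cast
  rfl

variable {k' : ℝ≥0} (hk' : k' ≤ 1)

/-- As long as no bid wins, the feedback does not depend on the charge. -/
theorem history_thresholdLaw_congr (A : Algorithm) (s : A.Seed) (z : ℕ → Unit) (t : ℕ)
    (h : ∀ i < t, bidAt A (thresholdLaw k hk) s z i ≤ 1 / 2) :
    history A (thresholdLaw k' hk') s z t = history A (thresholdLaw k hk) s z t := by
  induction t with
  | zero => rfl
  | succ t ih =>
    have hh := ih fun i hi => h i (hi.trans t.lt_succ_self)
    have hb : A.bid t s (history A (thresholdLaw k hk) s z t) (1 / 2) ≤ 1 / 2 :=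
      h t t.lt_succ_self
    change Fin.snoc (α := fun _ => Obs) (history A (thresholdLaw k' hk') s z t)
        ((1 / 2 : ℝ≥0),
          (thresholdLaw k' hk').x (z t) (A.bid t s (history A (thresholdLaw k' hk') s z t) (1 / 2)),
          (thresholdLaw k' hk').p (z t) (A.bid t s (history A (thresholdLaw k' hk') s z t) (1 / 2)))
      = Fin.snoc (α := fun _ => Obs) (history A (thresholdLaw k hk) s z t)
        ((1 / 2 : ℝ≥0),
          (thresholdLaw k hk).x (z t) (A.bid t s (history A (thresholdLaw k hk) s z t) (1 / 2)),
          (thresholdLaw k hk).p (z t) (A.bid t s (history A (thresholdLaw k hk) s z t) (1 / 2)))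
    rw [hh, thresholdLaw_x_of_le hk' hb, thresholdLaw_x_of_le hk hb, thresholdLaw_p_of_le hk' hb,
      thresholdLaw_p_of_le hk hb]

theorem bidAt_thresholdLaw_le (A : Algorithm) (s : A.Seed) (z : ℕ → Unit) {T t : ℕ} (ht : t < T)
    (h : ∀ i < T, bidAt A (thresholdLaw k hk) s z i ≤ 1 / 2) :
    bidAt A (thresholdLaw k' hk') s z t ≤ 1 / 2 := by
  have hh := history_thresholdLaw_congr hk hk' A s z t fun i hi => h i (hi.trans ht)
  change A.bid t s (history A (thresholdLaw k' hk') s z t) (1 / 2) ≤ 1 / 2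
  rw [hh]
  exact h t ht

end thresholdLaw

/-- Under first-price charges above the value, the constraint rules out winning altogether. -/
theorem ae_bidAt_le_of_ROSC_firstPrice {A : Algorithm} {T : ℕ}
    (h : ROSC A (thresholdLaw 1 le_rfl) T) :
    ∀ᵐ w ∂runLaw A (thresholdLaw 1 le_rfl),
      ∀ t < T, bidAt A (thresholdLaw 1 le_rfl) w.1 w.2 t ≤ 1 / 2 := by
  set D := thresholdLaw 1 le_rfl with hD
  have hslot : ∀ (z : Unit) (b : ℝ≥0), (D.v z : ℝ) * D.x z b ≤ D.p z b ∧
      (D.p z b = (D.v z : ℝ) * D.x z b → b ≤ 1 / 2) := by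
    intro z b
    rcases le_or_gt b (1 / 2) with hb | hb
    · rw [thresholdLaw_x_of_le _ hb, thresholdLaw_p_of_le _ hb, mul_zero]
      exact ⟨le_rfl, fun _ => hb⟩
    · have hb' : (1 / 2 : ℝ) < b := by exact_mod_cast hb
      have : (1 / 2 : ℝ) < min (((1 : ℝ≥0) : ℝ) * b) 1 :=
        lt_min (by simpa using hb') (by norm_num)
      rw [thresholdLaw_x_of_lt _ hb, thresholdLaw_p_of_lt _ hb, thresholdLaw_v, mul_one]
      exact ⟨this.le, fun he => absurd he this.ne'⟩
  have hle : ∀ w : A.Seed × (ℕ → D.Slot),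
      ∑ t ∈ Finset.range T, (D.v (w.2 t) : ℝ) * D.x (w.2 t) (bidAt A D w.1 w.2 t) ≤
        ∑ t ∈ Finset.range T, D.p (w.2 t) (bidAt A D w.1 w.2 t) :=
    fun w => Finset.sum_le_sum fun t _ => (hslot _ _).1
  -- Payment dominates value slot by slot, so the ROSC makes the expectations equal, hence the
  -- totals almost surely equal, hence every slot's terms equal.
  have heq := (integral_eq_iff_of_ae_le (integrable_total_value A D T)
    (integrable_total_payment A D T) (Filter.Eventually.of_forall hle)).1
    (le_antisymm (integral_mono (integrable_total_value A D T)
      (integrable_total_payment A D T) hle) h)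
  filter_upwards [heq] with w hw t ht
  exact (hslot _ _).2
    ((Finset.sum_eq_sum_iff_of_le fun t _ => (hslot _ _).1).1 hw t (Finset.mem_range.2 ht)).symm

/-- An algorithm that respects the constraint never wins a query that overbidding would get for
free. -/
theorem value_free_eq_zero {A : Algorithm} {T : ℕ} (h : RespectsROSC A T) :
    value A (thresholdLaw 0 zero_le_one) T = 0 := by
  refine integral_eq_zero_of_ae ?_
  -- `runLaw` does not see the charge: both laws give definitionally the same measure, so the almost
  -- sure statement transfers.
  have hae : ∀ᵐ w ∂runLaw A (thresholdLaw 0 zero_le_one),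
      ∀ t < T, bidAt A (thresholdLaw 1 le_rfl) w.1 w.2 t ≤ 1 / 2 :=
    ae_bidAt_le_of_ROSC_firstPrice (h _)
  filter_upwards [hae] with w hw
  refine Finset.sum_eq_zero fun t ht => ?_
  rw [thresholdLaw_x_of_le (z := w.2 t) _
    (bidAt_thresholdLaw_le le_rfl zero_le_one A w.1 w.2 (Finset.mem_range.1 ht) hw), mul_zero]

/-- The algorithm that always bids `1`. -/
def bidOne : Algorithm where
  Seed := Unit
  seedLaw := Measure.dirac ()
  bid := fun _ _ _ _ => 1
  measurable_bid := fun _ => measurable_const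

/-! ### The benchmark under free wins -/

theorem payment_bidOne_free (T : ℕ) : payment bidOne (thresholdLaw 0 zero_le_one) T = 0 := by
  refine integral_eq_zero_of_ae (Filter.Eventually.of_forall fun w => ?_)
  refine Finset.sum_eq_zero fun t _ => ?_
  change (thresholdLaw 0 zero_le_one).p (w.2 t) 1 = 0
  rw [thresholdLaw_p_of_lt (z := w.2 t) _ (half_lt_self zero_lt_one)]
  simp

theorem value_bidOne_free (T : ℕ) : value bidOne (thresholdLaw 0 zero_le_one) T = T / 2 := by
  have hs : ∀ w : bidOne.Seed × (ℕ → (thresholdLaw 0 zero_le_one).Slot),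
      ∑ t ∈ Finset.range T, ((thresholdLaw 0 zero_le_one).v (w.2 t) : ℝ) *
        (thresholdLaw 0 zero_le_one).x (w.2 t)
          (bidAt bidOne (thresholdLaw 0 zero_le_one) w.1 w.2 t) = T / 2 := by
    intro w
    have : ∀ t ∈ Finset.range T, ((thresholdLaw 0 zero_le_one).v (w.2 t) : ℝ) *
        (thresholdLaw 0 zero_le_one).x (w.2 t)
          (bidAt bidOne (thresholdLaw 0 zero_le_one) w.1 w.2 t) = 1 / 2 := by
      intro t _
      change _ * (thresholdLaw 0 zero_le_one).x (w.2 t) 1 = 1 / 2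
      rw [thresholdLaw_x_of_lt (z := w.2 t) _ (half_lt_self zero_lt_one), thresholdLaw_v _ (w.2 t), mul_one]
    rw [Finset.sum_congr rfl this]
    simp [div_eq_mul_inv]
  rw [value, integral_congr_ae (Filter.Eventually.of_forall hs)]
  simp

theorem half_mul_le_optValue_free (T : ℕ) :
    (T : ℝ) / 2 ≤ optValue (thresholdLaw 0 zero_le_one) T := by
  rw [← value_bidOne_free T]
  refine value_le_optValue ?_
  rw [ROSC, payment_bidOne_free]
  exact value_nonneg _ _ _

theorem half_mul_le_regret {A : Algorithm} {T : ℕ} (h : RespectsROSC A T) :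
    1 / 2 * (T : ℝ) ≤ regret A T := by
  have := optValue_sub_value_le_regret A (thresholdLaw 0 zero_le_one) T
  rw [value_free_eq_zero h] at this
  linarith [half_mul_le_optValue_free T]

end AutoBidding

end

theorem mainTheorem8 :
    (∀ T : ℕ, AutoBidding.RespectsROSC AutoBidding.truthful T) ∧
    (∃ C : ℝ, 0 < C ∧ ∀ T : ℕ, AutoBidding.regret AutoBidding.truthful T ≤ C * (T : ℝ)) ∧
    (∃ c : ℝ, 0 < c ∧ ∀ (T : ℕ) (A : AutoBidding.Algorithm),
      AutoBidding.RespectsROSC A T → c * (T : ℝ) ≤ AutoBidding.regret A T) ∧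
    (∃ K : ℝ, 0 < K ∧ ∀ (T : ℕ) (A : AutoBidding.Algorithm),
      AutoBidding.RespectsROSC A T →
        AutoBidding.regret AutoBidding.truthful T ≤ K * AutoBidding.regret A T) := by
  refine ⟨AutoBidding.truthful_respectsROSC, ⟨1, one_pos, fun T => ?_⟩,
    ⟨1 / 2, by norm_num, fun T A h => AutoBidding.half_mul_le_regret h⟩,
    ⟨2, two_pos, fun T A h => ?_⟩⟩
  · rw [one_mul]
    exact AutoBidding.regret_le _ T
  -- `K = 2` is the ratio of the bounds `T` and `T / 2`.
  · linarith [AutoBidding.regret_le AutoBidding.truthful T, AutoBidding.half_mul_le_regret h]
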